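/- Let $X$ be a Tychonoff space and let $\lambda$ be a family of subsets of $X$ with $\bigcup\lambda = X$. Let $C_{\lambda,\rho}(X)$ be the set of all continuous functions $X\to\mathbb{R}$ with the topology of uniform convergence on the elements of $\lambda$, that is, the topology given by the uniformity generated by the sets $\{(f,g) : |f(x)-g(x)|<\varepsilon \text{ for all } x\in A\}$ with $A\in\lambda$ and $\varepsilon>0$. Let $\gamma$ be the family of all countable subsets of $X$. A topological space $Z$ is a $\mu$-space if every subset of $Z$ on which every continuous real-valued function on $Z$ is bounded has compact closure in $Z$. For $A\subseteq X$ and $x\in\overline A\setminus A$ consider the following game. At step $n\in\mathbb{N}$ player ONE chooses an open neighbourhood $V_n$ of $x$, and then player TWO chooses a set $S_n\subseteq A$ that is contained in $\overline{T_n}$ for some $T_n\in\gamma$. Player TWO wins if $\overline{\bigcup_n S_n}\cap\bigcap_n V_n\neq\emptyset$. The space $X$ is an $AV_\gamma$-space if for every non-closed $A\subseteq X$ there is a point $x\in\overline A\setminus A$ such that player TWO has a winning strategy in this game. The space $X$ is functionally generated by $\gamma$ if for every discontinuous $f:X\to\mathbb{R}$ there is $T\in\gamma$ such that no continuous $g:X\to\mathbb{R}$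 agrees with $f$ on $T$. (a) If $X$ is an $AV_\gamma$-space or $X$ is functionally generated by $\gamma$, then $C_{\lambda,\rho}(X)$ is a $\mu$-space. (b) The hypothesis of (a), and hence its conclusion, holds in each of the following cases: 1. $X$ is a $q$-space (each point has a sequence of neighbourhoods $U_n$ such that every sequence of points $y_n\in U_n$ has a cluster point in $X$); in particular, if $X$ is countably compact; 2. $X$ is a quasi-$k$-space (a set $A\subseteq X$ is closed whenever $A\cap C$ is closed in $C$ for every countably compact $C\subseteq X$); in particular, if $X$ is a $k$-space (the same with compact $C$); 3. $X$ has countable tightness (if $x\in\overline A$, then $x\in\overline B$ for some countable $B\subseteq A$); in particular, if $X$ is sequential or Fréchet–Urysohn; 4. $X$ is locally separable (each point has a neighbourhood that is a separable subspace); 5. $X$ has countable functional tightness (every $f:X\to\mathbb{R}$ whose restriction to each countable subset of $X$ is continuous is continuous). -/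

import Mathlib

open Set Filter Topology UniformConvergence

universe u

/-- A subset `A` of `Z` is bounded (in `Z`) if every continuous real-valued function on `Z` is
bounded on `A`. -/
def IsBoundedIn {Z : Type u} [TopologicalSpace Z] (A : Set Z) : Prop :=
  ∀ f : Z → ℝ, Continuous f → Bornology.IsBounded (f '' A)

/-- A `μ`-space: every bounded subset has compact closure. -/
def IsMuSpace (Z : Type u) [TopologicalSpace Z] : Prop :=
  ∀ A : Set Z, IsBoundedIn A → IsCompact (closure A)

/-- `C_{λ,ρ}(X)`: the continuous functions `X → ℝ` with the topology of uniform convergence on the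
elements of `lam`, where `ℝ` carries its usual metric. It is the subspace of continuous functions
of Mathlib's space `X →ᵤ[lam] ℝ`, so its uniformity is generated by the sets
`{(f, g) | ∀ x ∈ A, (f x, g x) ∈ M}` with `A ∈ lam` and `M` an entourage of `ℝ`. -/
abbrev ContUnifOn (X : Type u) [TopologicalSpace X] (lam : Set (Set X)) : Type u :=
  {f : X →ᵤ[lam] ℝ // Continuous (UniformOnFun.toFun lam f)}

/-- Player TWO has a winning strategy in the Asanov–Velichko game generated by `lam`, for the set
`A` and the point `x`. At step `n` player ONE chooses an open neighbourhood `V n` of `x`; then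
player TWO chooses a subset `S n` of `A` lying in the closure of some element of `lam`. Player TWO
wins if `closure (⋃ n, S n)` meets `⋂ n, V n`. A strategy `σ` of player TWO maps each finite
sequence `[V 0, …, V n]` of moves of player ONE to the answer `S n`. -/
def TwoWinsAV {X : Type u} [TopologicalSpace X] (lam : Set (Set X)) (A : Set X) (x : X) : Prop :=
  ∃ σ : List (Set X) → Set X,
    ∀ V : ℕ → Set X, (∀ n, IsOpen (V n) ∧ x ∈ V n) →
      (∀ n, σ ((List.range (n + 1)).map V) ⊆ A ∧
        ∃ T ∈ lam, σ ((List.range (n + 1)).map V) ⊆ closure T) ∧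
      (closure (⋃ n, σ ((List.range (n + 1)).map V)) ∩ ⋂ n, V n).Nonempty

/-- `X` is Asanov–Velichko generated by `lam` (an `AV_lam`-space). -/
def IsAVSpace (X : Type u) [TopologicalSpace X] (lam : Set (Set X)) : Prop :=
  ∀ A : Set X, ¬ IsClosed A → ∃ x ∈ closure A \ A, TwoWinsAV lam A x

/-- `X` is functionally generated by `lam`: for every discontinuous `f : X → ℝ` there is `A ∈ lam`
such that the restriction of `f` to `A` has no continuous extension `X → ℝ`. -/
def IsFunctionallyGenerated (X : Type u) [TopologicalSpace X] (lam : Set (Set X)) : Prop :=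
  ∀ f : X → ℝ, ¬ Continuous f →
    ∃ A ∈ lam, ¬ ∃ g : X → ℝ, Continuous g ∧ ∀ x ∈ A, g x = f x

/-- The family of all countable subsets of `X`. -/
def countableSubsets (X : Type u) : Set (Set X) := {T | T.Countable}

/-- A `q`-space: each point has a sequence of neighbourhoods `U n` such that every sequence
`y n ∈ U n` has a cluster point in the space. -/
def IsQSpace (X : Type u) [TopologicalSpace X] : Prop :=
  ∀ x : X, ∃ U : ℕ → Set X, (∀ n, U n ∈ 𝓝 x) ∧
    ∀ y : ℕ → X, (∀ n, y n ∈ U n) → ∃ z, MapClusterPt z atTop y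

/-- A quasi-`k`-space: a set is open (closed) as soon as its trace on each countably compact
subset `C` is relatively open (closed) in `C`. -/
def IsQuasiKSpace (X : Type u) [TopologicalSpace X] : Prop :=
  IsCoherentWith {C : Set X | IsCountablyCompact C}

/-- A space of countable tightness. -/
def HasCountableTightness (X : Type u) [TopologicalSpace X] : Prop :=
  ∀ (A : Set X), ∀ x ∈ closure A, ∃ B ⊆ A, B.Countable ∧ x ∈ closure B

/-- A space of countable functional tightness: a real-valued function is continuous as soon as its
restriction to each countable subset is continuous. -/
def HasCountableFunctionalTightness (X : Type u) [TopologicalSpace X] : Prop :=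
  ∀ f : X → ℝ, (∀ B : Set X, B.Countable → ContinuousOn f B) → Continuous f

/-- A locally separable space: each point has a neighbourhood which is a separable subspace. -/
def IsLocallySeparable (X : Type u) [TopologicalSpace X] : Prop :=
  ∀ x : X, ∃ U ∈ 𝓝 x, TopologicalSpace.SeparableSpace U

/-! A bounded set `B` of functions restricts, on each member of `lam`, to a bounded set in a
metrizable space, hence to a totally bounded one. So `B` is totally bounded in the complete space `X
→ᵤ[lam] ℝ` and has compact closure there. It remains to see that pointwise limits `f` of `B` are
continuous (`isMuSpace_contUnifOn`).

The key is `ContUnifOn.exists_continuous_eqOn`: on a countable set, `f` agrees with some continuous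
function, since otherwise a weighted sum of the distances `|g (t n) - f (t n)|` would be positive
everywhere without being bounded away from zero on `B`. This settles the functionally generated
case. In the `AV` case, if `f ⁻¹' F` is not closed, ONE defeats any strategy of TWO by playing
neighbourhoods cut out by members of `B` that approximate `f` ever better on the answers so far
(`ContUnifOn.mem_of_twoWinsAV`). -/

/-! ### Boundedness and total boundedness -/

theorem IsBoundedIn.image {Y Z : Type*} [TopologicalSpace Y] [TopologicalSpace Z] {A : Set Y}
    (hA : IsBoundedIn A) {φ : Y → Z} (hφ : Continuous φ) : IsBoundedIn (φ '' A) := by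
  intro f hf
  rw [image_image]
  exact hA (fun y => f (φ y)) (hf.comp hφ)

/-- A continuous function which is positive on the whole space is bounded away from zero on a
bounded set. -/
theorem IsBoundedIn.exists_pos_le {Z : Type*} [TopologicalSpace Z] {A : Set Z}
    (hA : IsBoundedIn A) {φ : Z → ℝ} (hφ : Continuous φ) (hpos : ∀ z, 0 < φ z) :
    ∃ ε > 0, ∀ z ∈ A, ε ≤ φ z := by
  obtain ⟨C, hC⟩ := (hA (fun z => (φ z)⁻¹)
    (hφ.inv₀ fun z => (hpos z).ne')).exists_norm_le
  refine ⟨(max C 1)⁻¹, by positivity, fun z hz => ?_⟩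
  have h := hC _ (mem_image_of_mem _ hz)
  rw [Real.norm_of_nonneg (inv_nonneg.2 (hpos z).le)] at h
  exact inv_le_of_inv_le₀ (hpos z) (h.trans (le_max_left _ _))

/-- Bounded subsets of a metric space are totally bounded. -/
theorem IsBoundedIn.totallyBounded_of_metricSpace {Z : Type*} [MetricSpace Z] {A : Set Z}
    (hA : IsBoundedIn A) : TotallyBounded A := by
  rw [Metric.totallyBounded_iff]
  by_contra! h
  obtain ⟨ε, hε, h⟩ := h
  have hstep : ∀ t : Set Z, t.Finite → ∃ a ∈ A, ∀ y ∈ t, ε ≤ dist a y := by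
    intro t ht
    obtain ⟨a, ha, hat⟩ := not_subset.1 (h t ht)
    refine ⟨a, ha, fun y hy => ?_⟩
    by_contra! hlt
    exact hat (mem_iUnion₂.2 ⟨y, hy, hlt⟩)
  obtain ⟨u, hu⟩ := exists_seq_of_forall_finset_exists (fun z => z ∈ A)
    (fun y z => ε ≤ dist y z) (fun s _ => by
      obtain ⟨a, ha, had⟩ := hstep s s.finite_toSet
      exact ⟨a, ha, fun y hy => by simpa [dist_comm] using had y hy⟩)
  have hpair : Pairwise fun m n => ε ≤ dist (u m) (u n) := by
    intro m n hmn
    rcases hmn.lt_or_gt with hlt | hlt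
    · exact hu.2 m n hlt
    · rw [dist_comm]; exact hu.2 n m hlt
  -- An infinite `ε`-separated sequence is closed and discrete, so by Tietze `u n ↦ n` extends to a
  -- continuous function unbounded on `A`.
  have hemb : IsClosedEmbedding u := Metric.isClosedEmbedding_of_pairwise_le_dist hε hpair
  obtain ⟨g, hg⟩ := ContinuousMap.exists_extension' (Y := ℝ) hemb
    ⟨fun n : ℕ => (n : ℝ), continuous_of_discreteTopology⟩
  obtain ⟨C, hC⟩ := (hA g g.continuous).exists_norm_le
  obtain ⟨n, hn⟩ := exists_nat_gt C
  have h1 := hC _ (mem_image_of_mem g (hu.1 n))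
  have h2 : g (u n) = n := congrFun hg n
  rw [h2, Real.norm_natCast] at h1
  linarith

theorem IsBoundedIn.totallyBounded {Z : Type*} [UniformSpace Z] [T0Space Z]
    [IsCountablyGenerated (uniformity Z)] {A : Set Z} (hA : IsBoundedIn A) :
    TotallyBounded A := by
  let _ := UniformSpace.metricSpace Z
  exact hA.totallyBounded_of_metricSpace

instance UniformFun.isCountablyGenerated_uniformity {α β : Type*} [UniformSpace β]
    [IsCountablyGenerated (uniformity β)] : IsCountablyGenerated (uniformity (α →ᵤ β)) := by
  obtain ⟨V, hV⟩ := (uniformity β).exists_antitone_basis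
  exact (UniformFun.hasBasis_uniformity_of_basis α β hV.toHasBasis).isCountablyGenerated

/-- The uniformity is induced from the product of the spaces `K →ᵤ β`, so an ultrafilter is Cauchy
once all its restrictions are. -/
theorem UniformOnFun.totallyBounded_of_restrict {α β : Type*} [UniformSpace β]
    {lam : Set (Set α)} {A : Set (α →ᵤ[lam] β)}
    (h : ∀ K ∈ lam, TotallyBounded
      ((fun f : α →ᵤ[lam] β => UniformFun.ofFun (K.domRestrict (UniformOnFun.toFun lam f))) '' A)) :
    TotallyBounded A := by
  rw [totallyBounded_iff_ultrafilter]
  intro F hF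
  rw [← UniformOnFun.isUniformInducing_pi_restrict.cauchy_map_iff]
  refine ⟨inferInstance, ?_⟩
  rw [Pi.uniformity]
  refine le_iInf fun ⟨K, hK⟩ => ?_
  have := totallyBounded_iff_ultrafilter.1 (h K hK)
    (F.map fun f : α →ᵤ[lam] β => UniformFun.ofFun (K.domRestrict (UniformOnFun.toFun lam f)))
    (by rw [le_principal_iff] at hF ⊢
        exact image_mem_map hF)
  rw [← map_le_iff_le_comap, prod_map_map_eq, map_map]
  have hle := this.2
  rwa [Ultrafilter.coe_map, prod_map_map_eq] at hle

/-! ### Pointwise limits of bounded sets of functions -/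

section

variable {X : Type u} [TopologicalSpace X] {lam : Set (Set X)}

theorem ContUnifOn.continuous_eval (hlam : ⋃₀ lam = univ) (x : X) :
    Continuous fun g : ContUnifOn X lam => UniformOnFun.toFun lam g.1 x :=
  (UniformOnFun.uniformContinuous_eval hlam x).continuous.comp continuous_subtype_val

theorem IsBoundedIn.totallyBounded_image_val {B : Set (ContUnifOn X lam)} (hB : IsBoundedIn B) :
    TotallyBounded (Subtype.val '' B) := by
  refine UniformOnFun.totallyBounded_of_restrict fun K hK => ?_
  refine IsBoundedIn.totallyBounded ?_
  rw [image_image]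
  exact hB.image ((UniformOnFun.uniformContinuous_restrict X ℝ lam hK).continuous.comp
    continuous_subtype_val)

/-- The pointwise closure of a set of functions in `C_{λ,ρ}(X)`. -/
def ContUnifOn.pointwiseClosure (B : Set (ContUnifOn X lam)) : Set (X → ℝ) :=
  closure ((fun g : ContUnifOn X lam => UniformOnFun.toFun lam g.1) '' B)

theorem ContUnifOn.mem_pointwiseClosure_approx {B : Set (ContUnifOn X lam)} {f : X → ℝ}
    (hf : f ∈ ContUnifOn.pointwiseClosure B) {t : Set X} (ht : t.Finite) {ε : ℝ} (hε : 0 < ε) :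
    ∃ g ∈ B, ∀ x ∈ t, |UniformOnFun.toFun lam g.1 x - f x| < ε := by
  have hU : (t.pi fun x => Metric.ball (f x) ε) ∈ 𝓝 f :=
    set_pi_mem_nhds ht fun x _ => Metric.ball_mem_nhds _ hε
  obtain ⟨_, hg, g, hgB, rfl⟩ := mem_closure_iff_nhds.1 hf _ hU
  exact ⟨g, hgB, fun x hx => by simpa [Real.dist_eq] using hg x hx⟩

/-- Evaluations are bounded on `B`, so `B` lies in a product of compact intervals. This provides
cluster points in the game argument. -/
theorem ContUnifOn.isCompact_pointwiseClosure (hlam : ⋃₀ lam = univ)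
    {B : Set (ContUnifOn X lam)} (hB : IsBoundedIn B) :
    IsCompact (ContUnifOn.pointwiseClosure B) := by
  choose C hC using fun x => (hB _ (ContUnifOn.continuous_eval hlam x)).exists_norm_le
  refine (isCompact_univ_pi fun x => isCompact_closedBall (0 : ℝ) (C x)).of_isClosed_subset
    isClosed_closure (closure_minimal ?_
      (isClosed_set_pi fun x _ => Metric.isClosed_closedBall))
  rintro _ ⟨g, hg, rfl⟩ x -
  simpa using hC x _ (mem_image_of_mem _ hg)

/-- A pointwise limit of a bounded set of continuous functions coincides on each countable set
with some continuous function. -/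
theorem ContUnifOn.exists_continuous_eqOn (hlam : ⋃₀ lam = univ)
    {B : Set (ContUnifOn X lam)} (hB : IsBoundedIn B) {f : X → ℝ}
    (hf : f ∈ ContUnifOn.pointwiseClosure B) {T : Set X} (hT : T.Countable) :
    ∃ g : X → ℝ, Continuous g ∧ ∀ x ∈ T, g x = f x := by
  rcases T.eq_empty_or_nonempty with rfl | hne
  · exact ⟨fun _ => 0, continuous_const, by simp⟩
  obtain ⟨t, rfl⟩ := hT.exists_eq_range hne
  by_contra! hno
  let φ : ℕ → ContUnifOn X lam → ℝ := fun n g =>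
    (1 / 2 : ℝ) ^ n * min 1 |UniformOnFun.toFun lam g.1 (t n) - f (t n)|
  have hφ0 : ∀ n g, 0 ≤ φ n g := fun n g => by positivity
  have hφ1 : ∀ n g, φ n g ≤ (1 / 2 : ℝ) ^ n := fun n g =>
    mul_le_of_le_one_right (by positivity) (min_le_left _ _)
  have hs : Summable fun n : ℕ => (1 / 2 : ℝ) ^ n := summable_geometric_two
  have hsum : ∀ g, Summable fun n => φ n g := fun g =>
    hs.of_nonneg_of_le (fun n => hφ0 n g) fun n => hφ1 n g
  have hcont : Continuous fun g => ∑' n, φ n g := by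
    refine continuous_tsum (fun n => ?_) hs fun n g => ?_
    · have := ContUnifOn.continuous_eval (lam := lam) hlam (t n)
      fun_prop
    · rw [Real.norm_of_nonneg (hφ0 n g)]
      exact hφ1 n g
  obtain ⟨ε, hε, hle⟩ := hB.exists_pos_le hcont fun g => by
    obtain ⟨_, ⟨n, rfl⟩, hn⟩ := hno (UniformOnFun.toFun lam g.1) g.2
    refine (hsum g).tsum_pos (fun n => hφ0 n g) n ?_
    have : 0 < |UniformOnFun.toFun lam g.1 (t n) - f (t n)| := abs_pos.2 (sub_ne_zero.2 hn)
    positivity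
  -- The tail from `N` on is at most `2 * (1 / 2) ^ N < ε / 2`, and the first `N` terms add up to at
  -- most `2 * (ε / 4)`: the total is below `ε`.
  obtain ⟨N, hN⟩ := exists_pow_lt_of_lt_one (half_pos (half_pos hε))
    (by norm_num : (1 / 2 : ℝ) < 1)
  obtain ⟨g, hg, hgt⟩ := ContUnifOn.mem_pointwiseClosure_approx hf
    ((finite_Iio N).image t) (ε := ε / 4) (by positivity)
  have h1 : ∑ n ∈ Finset.range N, φ n g ≤ ∑ n ∈ Finset.range N, (1 / 2 : ℝ) ^ n * (ε / 4) :=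
    Finset.sum_le_sum fun n hn => by
      have := hgt (t n) (mem_image_of_mem _ (Finset.mem_range.1 hn))
      exact mul_le_mul_of_nonneg_left ((min_le_right _ _).trans this.le) (by positivity)
  have h2 : ∑ n ∈ Finset.range N, (1 / 2 : ℝ) ^ n ≤ 2 :=
    (hs.sum_le_tsum _ fun n _ => by positivity).trans_eq tsum_geometric_two
  have h3 : ∑' n, φ (n + N) g ≤ (1 / 2 : ℝ) ^ N * 2 := by
    refine le_of_le_of_eq ?_
      ((tsum_mul_left (f := fun n : ℕ => (1 / 2 : ℝ) ^ n)).trans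
        (congrArg _ tsum_geometric_two))
    refine ((summable_nat_add_iff N).2 (hsum g)).tsum_le_tsum (fun n => ?_) (hs.mul_left _)
    rw [← pow_add, add_comm N]
    exact hφ1 _ _
  have h4 := (hsum g).sum_add_tsum_nat_add N
  have h5 := hle g hg
  rw [← Finset.sum_mul] at h1
  nlinarith

/-- If all pointwise limits of bounded sets are continuous, then `C_{λ,ρ}(X)` is a `μ`-space. -/
theorem isMuSpace_contUnifOn (hlam : ⋃₀ lam = univ)
    (h : ∀ B : Set (ContUnifOn X lam), IsBoundedIn B →
      ∀ f ∈ ContUnifOn.pointwiseClosure B, Continuous f) :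
    IsMuSpace (ContUnifOn X lam) := by
  intro B hB
  have hcompact : IsCompact (closure (Subtype.val '' B)) :=
    hB.totallyBounded_image_val.closure.isCompact_of_isClosed isClosed_closure
  have hval : IsInducing (Subtype.val : ContUnifOn X lam → X →ᵤ[lam] ℝ) := .subtypeVal
  rw [hval.closure_eq_preimage_closure_image]
  -- Compactness passes to the subspace only if the whole closure consists of continuous functions.
  refine hval.isCompact_preimage' hcompact fun f hf => ?_
  have hc : Continuous (UniformOnFun.toFun lam : (X →ᵤ[lam] ℝ) → X → ℝ) :=
    continuous_pi fun x => (UniformOnFun.uniformContinuous_eval hlam x).continuous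
  have := image_closure_subset_closure_image hc (mem_image_of_mem _ hf)
  rw [image_image] at this
  exact ⟨⟨f, h B hB _ this⟩, rfl⟩

end

/-! ### Continuity of pointwise limits and the game -/

section

variable {X : Type u} [TopologicalSpace X] {lam : Set (Set X)}

/-- Adding one point `y` of the closure to `T` gives a continuous function that matches `f` at `y`
and `g` on `T`, hence `g` at `y`. -/
theorem ContUnifOn.exists_continuous_eqOn_closure (hlam : ⋃₀ lam = univ)
    {B : Set (ContUnifOn X lam)} (hB : IsBoundedIn B) {f : X → ℝ}
    (hf : f ∈ ContUnifOn.pointwiseClosure B) {T : Set X} (hT : T.Countable) :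
    ∃ g : X → ℝ, Continuous g ∧ EqOn f g (closure T) := by
  obtain ⟨g, hgc, hg⟩ := exists_continuous_eqOn hlam hB hf hT
  refine ⟨g, hgc, fun y hy => ?_⟩
  obtain ⟨k, hkc, hk⟩ := exists_continuous_eqOn hlam hB hf (hT.insert y)
  have heq : EqOn k g T := fun w hw => by rw [hg w hw, hk w (mem_insert_of_mem _ hw)]
  rw [← hk y (mem_insert _ _)]
  exact heq.closure hkc hgc hy

theorem ContUnifOn.eqOn_closure_of_eqOn (hlam : ⋃₀ lam = univ)
    {B : Set (ContUnifOn X lam)} (hB : IsBoundedIn B) {f h : X → ℝ}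
    (hf : f ∈ ContUnifOn.pointwiseClosure B) (hh : h ∈ ContUnifOn.pointwiseClosure B)
    {T : Set X} (hT : T.Countable) (hfh : EqOn f h T) : EqOn f h (closure T) := by
  obtain ⟨f', hf'c, hf'⟩ := exists_continuous_eqOn_closure hlam hB hf hT
  obtain ⟨h', hh'c, hh'⟩ := exists_continuous_eqOn_closure hlam hB hh hT
  have heq : EqOn f' h' T := fun x hx => by
    rw [← hf' (subset_closure hx), ← hh' (subset_closure hx), hfh hx]
  exact (hf'.trans (heq.closure hf'c hh'c)).trans hh'.symm

theorem closure_iUnion_subset_closure_iUnion {S T : ℕ → Set X} (h : ∀ n, S n ⊆ closure (T n)) :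
    closure (⋃ n, S n) ⊆ closure (⋃ n, T n) :=
  closure_minimal (iUnion_subset fun n => (h n).trans (closure_mono (subset_iUnion T n)))
    isClosed_closure

theorem ContUnifOn.continuous_of_isFunctionallyGenerated (hlam : ⋃₀ lam = univ)
    (hX : IsFunctionallyGenerated X (countableSubsets X))
    {B : Set (ContUnifOn X lam)} (hB : IsBoundedIn B) {f : X → ℝ}
    (hf : f ∈ ContUnifOn.pointwiseClosure B) : Continuous f := by
  by_contra hfc
  obtain ⟨T, hT, hno⟩ := hX f hfc
  exact hno (exists_continuous_eqOn hlam hB hf hT)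

/-- The sequence of positions of a play in which player ONE answers with `m`. -/
def playAgainst {α : Type*} (m : List α → α) : ℕ → List α
  | 0 => []
  | n + 1 => playAgainst m n ++ [m (playAgainst m n)]

theorem playAgainst_eq_map_range {α : Type*} (m : List α → α) (n : ℕ) :
    playAgainst m n = (List.range n).map fun k => m (playAgainst m k) := by
  induction n with
  | zero => rfl
  | succ n ih => rw [List.range_succ, List.map_append, ← ih]; rfl

/-- Player TWO has no winning strategy against functions with arbitrarily good
finite approximations. -/
theorem ContUnifOn.mem_of_twoWinsAV (hlam : ⋃₀ lam = univ)
    {B : Set (ContUnifOn X lam)} (hB : IsBoundedIn B) {f : X → ℝ}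
    (hf : f ∈ ContUnifOn.pointwiseClosure B) {F : Set ℝ} (hF : IsClosed F) {x : X}
    (hx : TwoWinsAV (countableSubsets X) (f ⁻¹' F) x) : f x ∈ F := by
  classical
  by_contra hxF
  obtain ⟨δ, hδ, hball⟩ := Metric.isOpen_iff.1 hF.isOpen_compl _ hxF
  obtain ⟨σ, hσ⟩ := hx
  -- an enumeration of a countable set whose closure contains the answer of TWO
  have henum : ∀ L : List (Set X), ∃ e : ℕ → X,
      (∃ T ∈ countableSubsets X, σ L ⊆ closure T) → σ L ⊆ closure (range e) := by
    intro L
    by_cases hT : ∃ T ∈ countableSubsets X, σ L ⊆ closure T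
    · obtain ⟨T, hTc, hLT⟩ := hT
      -- The point `x` is added only to make the set nonempty, so that `ℕ` enumerates it.
      obtain ⟨e, he⟩ := (Countable.insert x hTc).exists_eq_range (insert_nonempty _ _)
      exact ⟨e, fun _ => he ▸ hLT.trans (closure_mono (subset_insert _ _))⟩
    · exact ⟨fun _ => x, fun h => absurd h hT⟩
  choose e he using henum
  -- When ONE has made the moves `L`, TWO has answered the prefixes `L.take (k + 1)` with `k <
  -- L.length`. The first `L.length` points of each enumeration are collected, so every point is
  -- eventually included.
  let pts : List (Set X) → Set X := fun L => insert x
    ((fun p : ℕ × ℕ => e (L.take (p.1 + 1)) p.2) '' (Iio L.length ×ˢ Iio L.length))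
  -- The bound `δ / 2` at `x` makes ONE's move a neighbourhood of `x`; the bound `1 / (L.length +
  -- 1)` forces convergence to `f` on the enumerated points.
  have happrox : ∀ L : List (Set X), ∃ g ∈ B, ∀ y ∈ pts L,
      |UniformOnFun.toFun lam g.1 y - f y| < min (δ / 2) (1 / ((L.length : ℝ) + 1)) := fun L =>
    mem_pointwiseClosure_approx hf
      ((((finite_Iio _).prod (finite_Iio _)).image _).insert _) (by positivity)
  choose g hgB hg using happrox
  let m : List (Set X) → Set X := fun L =>
    {y | |UniformOnFun.toFun lam (g L).1 y - f x| < δ / 2}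
  let P : ℕ → List (Set X) := playAgainst m
  have hP : ∀ n, (List.range n).map (fun k => m (P k)) = P n := fun n =>
    (playAgainst_eq_map_range m n).symm
  have hlen : ∀ n, (P n).length = n := fun n => by rw [← hP]; simp
  have htake : ∀ k n, k < n → (P n).take (k + 1) = P (k + 1) := fun k n hkn => by
    rw [← hP n, ← hP (k + 1), ← List.map_take, List.take_range, min_eq_left hkn]
  obtain ⟨hans, z, hzcl, hzV⟩ := hσ (fun n => m (P n)) fun n =>
    ⟨isOpen_lt (((g (P n)).2.sub continuous_const).abs) continuous_const,
      (hg (P n) x (mem_insert _ _)).trans_le (min_le_left _ _)⟩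
  simp only [hP] at hans hzcl
  -- a cluster point of the functions chosen by ONE
  obtain ⟨h, hh, hclus⟩ := (isCompact_pointwiseClosure hlam hB).exists_mapClusterPt
    (u := fun n => UniformOnFun.toFun lam (g (P n)).1) (f := atTop)
    (tendsto_principal.2 <| Eventually.of_forall fun n =>
      subset_closure (mem_image_of_mem _ (hgB _)))
  have heval : ∀ y, MapClusterPt (h y) atTop fun n => UniformOnFun.toFun lam (g (P n)).1 y :=
    fun y => hclus.continuousAt_comp (f := fun k : X → ℝ => k y)
      (continuous_apply y).continuousAt
  have hfh : EqOn f h (⋃ k, range (e (P (k + 1)))) := by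
    intro y hy
    obtain ⟨k, j, rfl⟩ := mem_iUnion.1 hy
    set y := e (P (k + 1)) j
    have hlim : Tendsto (fun n => UniformOnFun.toFun lam (g (P n)).1 y) atTop (𝓝 (f y)) := by
      rw [tendsto_iff_norm_sub_tendsto_zero]
      refine squeeze_zero' (Eventually.of_forall fun n => norm_nonneg _) ?_
        (tendsto_one_div_add_atTop_nhds_zero_nat (𝕜 := ℝ))
      filter_upwards [eventually_gt_atTop (max k j)] with n hn
      have hy : y ∈ pts (P n) := by
        refine mem_insert_of_mem _ ⟨(k, j), ?_, ?_⟩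
        · rw [hlen]
          exact ⟨(le_max_left _ _).trans_lt hn, (le_max_right _ _).trans_lt hn⟩
        · simp only [htake k n ((le_max_left _ _).trans_lt hn), y]
      have := (hg (P n) y hy).le.trans (min_le_right _ _)
      rwa [hlen] at this
    exact (eq_of_nhds_neBot ((heval y).clusterPt.mono hlim)).symm
  have hzT := closure_iUnion_subset_closure_iUnion (fun n => he _ (hans n).2) hzcl
  have hfz : f z ∈ F := by
    have hcount : (⋃ k, range (e (P (k + 1)))).Countable :=
      countable_iUnion fun k => countable_range _
    obtain ⟨f', hf'c, hff'⟩ := exists_continuous_eqOn_closure hlam hB hf hcount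
    have hsub : (⋃ n, σ (P (n + 1))) ⊆ f' ⁻¹' F := fun y hy => by
      have hy' := hff' (closure_iUnion_subset_closure_iUnion (fun n => he _ (hans n).2)
        (subset_closure hy))
      obtain ⟨n, hn⟩ := mem_iUnion.1 hy
      have : f y ∈ F := (hans n).1 hn
      rwa [hy'] at this
    rw [hff' hzT]
    exact closure_minimal hsub (hF.preimage hf'c) hzcl
  -- Since `z` lies in all of ONE's moves, the cluster value `h z` is within `δ / 2` of `f x`. As `h
  -- z = f z`, this contradicts `f z ∈ F`.
  have hhz : h z ∈ Metric.closedBall (f x) (δ / 2) :=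
    Metric.isClosed_closedBall.mem_of_mapClusterPt (heval z) (Eventually.of_forall fun n => by
      have : |UniformOnFun.toFun lam (g (P n)).1 z - f x| < δ / 2 := mem_iInter.1 hzV n
      simpa [Real.dist_eq] using this.le)
  rw [← eqOn_closure_of_eqOn hlam hB hf hh (countable_iUnion fun k => countable_range _) hfh hzT]
    at hhz
  exact hball (Metric.closedBall_subset_ball (half_lt_self hδ) hhz) hfz

theorem ContUnifOn.continuous_of_isAVSpace (hlam : ⋃₀ lam = univ)
    (hX : IsAVSpace X (countableSubsets X))
    {B : Set (ContUnifOn X lam)} (hB : IsBoundedIn B) {f : X → ℝ}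
    (hf : f ∈ ContUnifOn.pointwiseClosure B) : Continuous f := by
  refine continuous_iff_isClosed.2 fun F hF => ?_
  by_contra hnc
  obtain ⟨x, hx, hwin⟩ := hX _ hnc
  exact hx.2 (mem_of_twoWinsAV hlam hB hf hF hwin)

end

/-! ### Classes of spaces satisfying the hypothesis -/

section

variable {X : Type u} [TopologicalSpace X]

/-- Player TWO wins by always playing a fixed set, if the point lies in its closure. -/
theorem twoWinsAV_of_mem_closure {lam : Set (Set X)} {A S T : Set X} {x : X} (hS : S ⊆ A)
    (hT : T ∈ lam) (hST : S ⊆ closure T) (hx : x ∈ closure S) : TwoWinsAV lam A x :=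
  ⟨fun _ => S, fun V hV => ⟨fun _ => ⟨hS, T, hT, hST⟩,
    x, by rwa [iUnion_const], mem_iInter.2 fun n => (hV n).2⟩⟩

/-- Player TWO wins by playing points of suitable sets in which all sequences cluster. -/
theorem twoWinsAV_of_mapClusterPt [RegularSpace X] {A : Set X} {x : X} (U : ℕ → Set X)
    (hU : ∀ n, ∀ N ∈ 𝓝 x, (A ∩ U n ∩ N).Nonempty)
    (hclus : ∀ y : ℕ → X, (∀ n, y n ∈ U n) → ∃ z, MapClusterPt z atTop y) :
    TwoWinsAV (countableSubsets X) A x := by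
  -- By regularity TWO can shrink each move to a closed neighbourhood, which keeps the cluster
  -- points of later answers. The default `univ` makes `K` total.
  have hc : ∀ V : Set X, ∃ K ∈ 𝓝 x, IsClosed K ∧ (V ∈ 𝓝 x → K ⊆ V) := by
    intro V
    by_cases hV : V ∈ 𝓝 x
    · obtain ⟨K, hK, hKc, hKV⟩ := exists_mem_nhds_isClosed_subset hV
      exact ⟨K, hK, hKc, fun _ => hKV⟩
    · exact ⟨univ, univ_mem, isClosed_univ, fun h => absurd h hV⟩
  choose K hK hKc hKV using hc
  have hN : ∀ L : List (Set X), (⋂ V ∈ L, K V) ∈ 𝓝 x := fun L =>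
    (biInter_mem (List.finite_toSet L)).2 fun V _ => hK V
  -- At step `n` the list has length `n + 1`, so the answer lies in `U n`.
  choose y hy using fun L : List (Set X) => hU (L.length - 1) _ (hN L)
  refine ⟨fun L => {y L}, fun V hV => ⟨fun n => ⟨?_, ?_⟩, ?_⟩⟩
  · exact singleton_subset_iff.2 (hy _).1.1
  · exact ⟨_, countable_singleton _, subset_closure⟩
  · obtain ⟨z, hz⟩ := hclus (fun n => y ((List.range (n + 1)).map V)) fun n => by
      simpa using (hy ((List.range (n + 1)).map V)).1.2
    refine ⟨z, ?_, mem_iInter.2 fun n => ?_⟩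
    · exact isClosed_closure.mem_of_mapClusterPt hz
        (Eventually.of_forall fun n => subset_closure (mem_iUnion.2 ⟨n, rfl⟩))
    · refine hKV _ ((hV n).1.mem_nhds (hV n).2) ((hKc (V n)).mem_of_mapClusterPt hz ?_)
      filter_upwards [eventually_ge_atTop n] with k hk
      exact mem_iInter₂.1 (hy _).2 (V n)
        (List.mem_map.2 ⟨n, List.mem_range.2 (Nat.lt_succ_of_le hk), rfl⟩)

theorem exists_mem_closure_diff {A : Set X} (hA : ¬ IsClosed A) : (closure A \ A).Nonempty := by
  rw [nonempty_iff_ne_empty, Ne, sdiff_eq_empty]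
  exact fun h => hA (isClosed_of_closure_subset h)

theorem IsQSpace.isAVSpace [RegularSpace X] (h : IsQSpace X) :
    IsAVSpace X (countableSubsets X) := by
  intro A hA
  obtain ⟨x, hx⟩ := exists_mem_closure_diff hA
  obtain ⟨U, hU, hclus⟩ := h x
  refine ⟨x, hx, twoWinsAV_of_mapClusterPt U (fun n N hN => ?_) hclus⟩
  rw [inter_assoc, inter_comm]
  exact mem_closure_iff_nhds.1 hx.1 _ (inter_mem (hU n) hN)

theorem IsQSpace.of_countablyCompactSpace [CountablyCompactSpace X] : IsQSpace X := by
  refine fun x => ⟨fun _ => univ, fun _ => univ_mem, fun y _ => ?_⟩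
  obtain ⟨z, -, hz⟩ := (CountablyCompactSpace.isCountablyCompact_univ (E := X)).seq_clusterPt y
    (by simp)
  exact ⟨z, hz⟩

theorem IsQuasiKSpace.isAVSpace [RegularSpace X] (h : IsQuasiKSpace X) :
    IsAVSpace X (countableSubsets X) := by
  intro A hA
  obtain ⟨C, hC, hCA⟩ : ∃ C : Set X, IsCountablyCompact C ∧
      ¬ IsClosed ((↑) ⁻¹' A : Set C) := by
    by_contra! hall
    refine hA (isOpen_compl_iff.1 (h.isOpen_of_forall_induced _ fun C hC => ?_))
    exact (hall C hC).isOpen_compl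
  obtain ⟨x, hxcl, hxA⟩ := exists_mem_closure_diff hCA
  rw [closure_subtype, Subtype.image_preimage_coe, inter_comm] at hxcl
  -- Here `x` is in the closure of `A ∩ C`, so TWO can always answer inside `C`, where every
  -- sequence clusters.
  refine ⟨x, ⟨closure_mono inter_subset_left hxcl, hxA⟩,
    twoWinsAV_of_mapClusterPt (fun _ => C) (fun n N hN => ?_) fun y hy => ?_⟩
  · rw [inter_comm]
    exact mem_closure_iff_nhds.1 hxcl N hN
  · obtain ⟨z, -, hz⟩ := hC.seq_clusterPt y (Eventually.of_forall hy)
    exact ⟨z, hz⟩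

theorem IsQuasiKSpace.of_compactlyCoherentSpace [CompactlyCoherentSpace X] : IsQuasiKSpace X :=
  ⟨fun u hu => CompactlyCoherentSpace.isCoherentWith.isOpen_of_forall_induced u
    fun K hK => hu K (IsCompact.isCountablyCompact hK)⟩

theorem HasCountableTightness.isAVSpace (h : HasCountableTightness X) :
    IsAVSpace X (countableSubsets X) := by
  intro A hA
  obtain ⟨x, hx⟩ := exists_mem_closure_diff hA
  obtain ⟨B, hBA, hB, hxB⟩ := h A x hx.1
  exact ⟨x, hx, twoWinsAV_of_mem_closure hBA hB subset_closure hxB⟩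

theorem SequentialSpace.isAVSpace [SequentialSpace X] : IsAVSpace X (countableSubsets X) := by
  intro A hA
  have hseq : ¬ IsSeqClosed A := fun h => hA h.isClosed
  simp only [IsSeqClosed, not_forall] at hseq
  obtain ⟨u, x, hu, hux, hxA⟩ := hseq
  have hx : x ∈ closure (range u) :=
    mem_closure_of_tendsto hux (Eventually.of_forall fun n => mem_range_self n)
  have hsub : range u ⊆ A := range_subset_iff.2 hu
  exact ⟨x, ⟨closure_mono hsub hx, hxA⟩,
    twoWinsAV_of_mem_closure hsub (countable_range u) subset_closure hx⟩

theorem IsLocallySeparable.isAVSpace (h : IsLocallySeparable X) :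
    IsAVSpace X (countableSubsets X) := by
  intro A hA
  obtain ⟨x, hx⟩ := exists_mem_closure_diff hA
  obtain ⟨U, hU, hsep⟩ := h x
  obtain ⟨D, hD, hUD⟩ := TopologicalSpace.IsSeparable.of_subtype U
  -- The answer `A ∩ U` may be uncountable; it only has to lie in the closure of the countable set
  -- `D`.
  refine ⟨x, hx, twoWinsAV_of_mem_closure (inter_subset_left (t := U)) hD
    (inter_subset_right.trans hUD) (mem_closure_iff_nhds.2 fun N hN => ?_)⟩
  rw [inter_comm A, ← inter_assoc]
  exact mem_closure_iff_nhds.1 hx.1 _ (inter_mem hN hU)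

theorem HasCountableFunctionalTightness.isFunctionallyGenerated
    (h : HasCountableFunctionalTightness X) :
    IsFunctionallyGenerated X (countableSubsets X) := by
  intro f hf
  by_contra! hno
  refine hf (h f fun B hB => ?_)
  obtain ⟨g, hg, hgf⟩ := hno B hB
  exact hg.continuousOn.congr fun x hx => (hgf x hx).symm

end

theorem corollary2p14 (X : Type u) [TopologicalSpace X] [T35Space X]
    (lam : Set (Set X)) (hlam : ⋃₀ lam = Set.univ) :
    ((IsAVSpace X (countableSubsets X) ∨ IsFunctionallyGenerated X (countableSubsets X)) →
      IsMuSpace (ContUnifOn X lam)) ∧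
    ((IsQSpace X ∨ CountablyCompactSpace X ∨
        IsQuasiKSpace X ∨ CompactlyCoherentSpace X ∨
        HasCountableTightness X ∨ SequentialSpace X ∨ FrechetUrysohnSpace X ∨
        IsLocallySeparable X ∨
        HasCountableFunctionalTightness X) →
      (IsAVSpace X (countableSubsets X) ∨ IsFunctionallyGenerated X (countableSubsets X)) ∧
        IsMuSpace (ContUnifOn X lam)) := by
  have hmain : (IsAVSpace X (countableSubsets X) ∨
      IsFunctionallyGenerated X (countableSubsets X)) → IsMuSpace (ContUnifOn X lam) := fun h =>
    isMuSpace_contUnifOn hlam fun B hB f hf => h.elim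
      (fun h => ContUnifOn.continuous_of_isAVSpace hlam h hB hf)
      (fun h => ContUnifOn.continuous_of_isFunctionallyGenerated hlam h hB hf)
  refine ⟨hmain, fun h => ?_⟩
  have hgen : IsAVSpace X (countableSubsets X) ∨
      IsFunctionallyGenerated X (countableSubsets X) := by
    rcases h with h | h | h | h | h | h | h | h | h
    · exact .inl h.isAVSpace
    · exact .inl IsQSpace.of_countablyCompactSpace.isAVSpace
    · exact .inl h.isAVSpace
    · exact .inl IsQuasiKSpace.of_compactlyCoherentSpace.isAVSpace
    · exact .inl h.isAVSpace
    · exact .inl SequentialSpace.isAVSpace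
    -- Fréchet–Urysohn spaces are sequential, by instance.
    · exact .inl SequentialSpace.isAVSpace
    · exact .inl h.isAVSpace
    · exact .inr h.isFunctionallyGenerated
  exact ⟨hgen, hmain hgen⟩
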